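/- A $(K,K',N)$ hotplug coded caching scheme consists of the following. A server holds $N$ files of $B\ge 1$ bits each. Each of $K$ users has a cache of $MB$ bits, which is filled with a function of the files before it is known which users will be active and what they will demand. Afterwards a set $I$ of $K'$ active users and their demands $(d_k)_{k\in I}\in[N]^I$ are revealed, and the server broadcasts $RB$ bits that depend on $I$, the demands and the files. For every $I$ with $|I|=K'$, every demand vector and every content of the files, each $k\in I$ must recover file $d_k$ exactly from its cache and the broadcast. A pair $(M,R)$ is achievable if for some $B$ there is such a scheme with caches of at most $MB$ bits and broadcasts of at most $RB$ bits. The rate $R$ is optimal at memory $M$ if it is the smallest rate achievable with memory $M$. Let $q\ge 3$ be a prime power, let $N\ge 1$, and let $a,a_1,a_2$ be integers with $0\le a_1\le q^2-q-1$, $0\le a_2\le q$, $0\le a<a_2$ and $q(q+1)=a+3a_1+2a_2$. Put $$\frac MN=\frac{q(q+1)}{3(a_1+a_2)},\qquad R=\frac{3(a_1+a_2)-q(q+1)}{3(a_1+a_2)}=1-\frac MN .$$ Then: 1. There is a $3$-$(q^2+1,q+1,1)$ design $(X,\mathcal A)$, with the set $X=[q^2+1]$ of users as point set, and a $(q^2+1,3,N)$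 hotplug coded caching scheme of memory exactly $M$ and rate exactly $R$ that is obtained from it as follows. Let $\mathcal R$ be the set of pairs $(Y,i)$ with $Y\subset\{1,2,3\}$, $|Y|\in\{1,2\}$, $1\le i\le a_{|Y|}$. Each file is divided into $|\mathcal R|=3(a_1+a_2)$ subfiles, which are elements of a field with $2^m$ elements, and encoded by an MDS code of dimension $|\mathcal R|$ into coded subfiles $C_{n,A}$, $A\in\mathcal A$. User $k$ caches all $C_{n,A}$ with $k\in A$. If the active users are $u_1<u_2<u_3$, there is an injection $\psi:\mathcal R\to\mathcal A$ with $u_j\in\psi(Y,i)\iff j\in Y$, and for each pair $s=(Y\cup\{j\},i)$ with $(Y,i)\in\mathcal R$, $j\notin Y$, outside a fixed set $T$ of pairs, the server sends $\sum C_{d_{u_j},\psi(Y,i)}$, the sum being over all $(Y,i)\in\mathcal R$ and $j\notin Y$ with $(Y\cup\{j\},i)=s$. 2. The point $(M,R)$ meets the cut-set bound: $$R=\max_{1\le s\le\min(N,3)}\Bigl(s-\frac{s}{\lfloor N/s\rfloor}M\Bigr).$$ 3. In the $(q^2+1,3,N)$ hotplug system, $R$ is optimal at memory $M$. -/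

import Mathlib

/-- A `(K, K', N)` hotplug coded caching scheme with files of `B` bits, caches of `c` bits and
transmissions of `r` bits.  The placement knows neither the active set `I` nor the demands `d`;
the delivery knows both.  Every active user must recover its file exactly, for every active set of
size `K'`, every demand vector and every content of the files. -/
structure HotplugScheme (K K' N B c r : ℕ) where
  /-- the cache of each user, as a function of the `N` files -/
  place : (Fin N → Fin B → Bool) → Fin K → Fin c → Bool
  /-- the broadcast, as a function of the active set, the demands and the files -/
  deliver : (I : Finset (Fin K)) → (I → Fin N) → (Fin N → Fin B → Bool) → Fin r → Bool
  /-- the decoder of an active user -/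
  decode : (I : Finset (Fin K)) → (I → Fin N) → I → (Fin c → Bool) → (Fin r → Bool) →
    Fin B → Bool
  correct : ∀ I : Finset (Fin K), I.card = K' → ∀ (d : I → Fin N) (W : Fin N → Fin B → Bool)
    (k : I), decode I d k (place W k) (deliver I d W) = W (d k)

/-- Memory `M` and rate `R` (both in units of files) are achievable in the `(K, K', N)` hotplug
system. -/
def IsAchievable (K K' N : ℕ) (M R : ℝ) : Prop :=
  ∃ B c r : ℕ, 0 < B ∧ (c : ℝ) ≤ M * B ∧ (r : ℝ) ≤ R * B ∧ Nonempty (HotplugScheme K K' N B c r)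

/-- `R` is optimal at memory `M`: it is the smallest achievable rate. -/
def IsOptimalRate (K K' N : ℕ) (M R : ℝ) : Prop :=
  IsLeast {R' : ℝ | IsAchievable K K' N M R'} R

/-- `R` equals the cut-set bound for `N` files, `K'` users and memory `M`, that is
`max_{1 ≤ s ≤ min (N, K')} (s - s / ⌊N / s⌋ * M)`. -/
def MeetsCutSetBound (N K' : ℕ) (M R : ℝ) : Prop :=
  IsGreatest ((fun s : ℕ => (s : ℝ) - (s : ℝ) / ((N / s : ℕ) : ℝ) * M) ''
    Set.Icc 1 (min N K')) R

/-- `t-(v, k, l)` designs (without repeated blocks) on the point set `X`. -/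
structure IsTDesign {X : Type} [Fintype X] [DecidableEq X] (t v k l : ℕ)
    (blocks : Finset (Finset X)) : Prop where
  t_pos : 0 < t
  l_pos : 0 < l
  t_le : t ≤ k
  k_lt : k < v
  card_points : Fintype.card X = v
  card_block : ∀ A ∈ blocks, A.card = k
  card_through : ∀ Y : Finset X, Y.card = t → (blocks.filter (fun A => Y ⊆ A)).card = l

/-- The division of `B`-bit files into subfiles indexed by `ρ`, of `m` bits each, read as elements
of a field with `2 ^ m` elements, together with the generator matrix of an MDS code whose coded
symbols are indexed by `φ`. -/
structure SubfileCode (ρ φ : Type) (B : ℕ) where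
  m : ℕ
  F : Type
  [field : Field F]
  split : Fin B ≃ ρ × Fin m
  symbol : (Fin m → Bool) ≃ F
  G : Matrix ρ φ F
  /-- any `|ρ|` columns of `G` are linearly independent -/
  mds : ∀ g : ρ ↪ φ, LinearIndependent F (fun i : ρ => fun f : ρ => G f (g i))

attribute [instance] SubfileCode.field

namespace SubfileCode

variable {ρ φ σ : Type} {B : ℕ}

/-- The subfile with index `f` of the file `w`. -/
def subfile (C : SubfileCode ρ φ B) (w : Fin B → Bool) (f : ρ) : C.F :=
  C.symbol (fun i => w (C.split.symm (f, i)))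

/-- The coded subfile with index `x` of the file `w`. -/
def coded [Fintype ρ] (C : SubfileCode ρ φ B) (w : Fin B → Bool) (x : φ) : C.F :=
  ∑ f : ρ, C.G f x * C.subfile w f

/-- The transmission attached to the integer `s` of the array `A`: the sum of the coded subfiles
`C_{w_j, ψ f}` over all positions `(f, j)` of `s` in `A`, where `w_j` is the file demanded by the
`j`-th active user. -/
def transmission [Fintype ρ] [DecidableEq σ] {K' : ℕ} (C : SubfileCode ρ φ B)
    (A : ρ → Fin K' → Option σ) (ψ : ρ ↪ φ) (w : Fin K' → Fin B → Bool) (s : σ) : C.F :=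
  ∑ f : ρ, ∑ j : Fin K', if A f j = some s then C.coded (w j) (ψ f) else 0

end SubfileCode

/-- `S` is the scheme obtained from the placement array `P` (`P x k` means that there is a star in
row `x` and column `k`) and the delivery array `A` (`none` is the star, `some s` the integer `s`)
from which the integers in `T` have been removed.

* The cache of user `k` consists of the coded subfiles of all files at the stars in column `k`.
* For an active set `I` there are rows `ψ` of `P` whose stars in the columns `I` are at the same
  positions as those of `A`, and the server sends one transmission for every integer of `A` that is
  not in `T`.

The bijections `e` fix the order in which the bits are stored and sent. -/
def IsArrayScheme {ρ φ σ : Type} [Fintype ρ] [DecidableEq σ] {K K' N B c r : ℕ}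
    (P : φ → Fin K → Prop) (A : ρ → Fin K' → Option σ) (T : Set σ)
    (S : HotplugScheme K K' N B c r) : Prop :=
  ∃ C : SubfileCode ρ φ B,
    (∀ k : Fin K, ∃ e : Fin c ≃ Fin N × {x : φ // P x k} × Fin C.m,
      ∀ (W : Fin N → Fin B → Bool) (b : Fin c),
        S.place W k b = C.symbol.symm (C.coded (W (e b).1) (e b).2.1) (e b).2.2) ∧
    ∀ (I : Finset (Fin K)) (hI : I.card = K'),
      ∃ ψ : ρ ↪ φ,
        (∀ f j, A f j = none ↔ P (ψ f) (I.orderIsoOfFin hI j)) ∧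
        ∀ d : I → Fin N,
          ∃ e : Fin r ≃ {s : σ // s ∉ T ∧ ∃ f j, A f j = some s} × Fin C.m,
            ∀ (W : Fin N → Fin B → Bool) (b : Fin r),
              S.deliver I d W b =
                C.symbol.symm
                  (C.transmission A ψ (fun j => W (d (I.orderIsoOfFin hI j))) (e b).1) (e b).2

/-- The placement array of a design: rows are blocks, columns are points, and the stars are at the
incidences. -/
def designPlacement {K : ℕ} (blocks : Finset (Finset (Fin K))) (A : {A // A ∈ blocks})
    (i : Fin K) : Prop :=
  i ∈ A.1

/-- The rows `(Y, i)` of the delivery array: `Y ⊆ [t]` with `1 ≤ |Y| ≤ t - 1` and `i ∈ [a_{|Y|}]`. -/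
abbrev DesignRow (t : ℕ) (a : ℕ → ℕ) : Type :=
  Σ Y : {Y : Finset (Fin t) // Y.Nonempty ∧ Y ≠ Finset.univ}, Fin (a Y.1.card)

/-- The delivery array: in row `(Y, i)` and column `j` there is a star if `j ∈ Y`, and the
"integer" `(Y ∪ {j}, i)` otherwise. -/
def designDelivery (t : ℕ) (a : ℕ → ℕ) (y : DesignRow t a) (j : Fin t) :
    Option (Finset (Fin t) × ℕ) :=
  if j ∈ y.1.1 then none else some (insert j y.1.1, (y.2 : ℕ))

/-!
The blocks are the images of the projective line over `𝔽_q` inside the projective line over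
`𝔽_{q²}` under projectivities. Projectivities are sharply transitive on triples of distinct points,
so any three points lie on exactly one block.

By inclusion–exclusion, given three points, `q² - q - 1` blocks meet them in a prescribed single
point and `q` blocks in a prescribed pair. As `a₁ ≤ q² - q - 1` and `a₂ ≤ q`, these blocks supply
the rows that reproduce the star pattern of the delivery array. In a transmission that involves
user `j`, all summands but one are cached by `j`. So from the `a₂ - a` transmissions `([3], i)` with
`i ≥ a` each user gains `a₂ - a` new coded subfiles of its file; together with the `q (q + 1)`
cached ones these are `3 (a₁ + a₂)` coded subfiles, and the MDS property gives the file.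

For the converse, the caches of `s` users together with `⌊N / s⌋` broadcasts determine
`s ⌊N / s⌋` files. As `M ≥ N / 2`, this bound is strongest at `s = 1`, where it reads
`R ≥ 1 - M / N`.
-/

section Sublines

open scoped OnePoint Pointwise MatrixGroups

theorem exists_smul_infty_eq {K : Type*} [Field K] [DecidableEq K] (a : OnePoint K) :
    ∃ g : GL (Fin 2) K, g • (∞ : OnePoint K) = a := by
  cases a with
  | infty => exact ⟨1, one_smul _ _⟩
  | coe a =>
    refine ⟨Matrix.GeneralLinearGroup.mkOfDetNeZero !![a, -1; 1, 0] (by simp), ?_⟩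
    simp [OnePoint.smul_infty_eq_ite, Matrix.GeneralLinearGroup.mkOfDetNeZero]

theorem exists_smul_infty_zero_one_eq {K : Type*} [Field K] [DecidableEq K] {a b c : OnePoint K}
    (hab : a ≠ b) (hac : a ≠ c) (hbc : b ≠ c) :
    ∃ g : GL (Fin 2) K, g • (∞ : OnePoint K) = a ∧ g • ((0 : K) : OnePoint K) = b ∧
      g • ((1 : K) : OnePoint K) = c := by
  obtain ⟨g, rfl⟩ := exists_smul_infty_eq a
  obtain ⟨x, hx⟩ := OnePoint.ne_infty_iff_exists.1 fun h => hab (inv_smul_eq_iff.1 h).symm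
  obtain ⟨y, hy⟩ := OnePoint.ne_infty_iff_exists.1 fun h => hac (inv_smul_eq_iff.1 h).symm
  have hyx : y - x ≠ 0 := by
    refine sub_ne_zero.2 fun h => hbc (smul_left_cancel g⁻¹ ?_)
    rw [← hx, ← hy, h]
  let f : GL (Fin 2) K :=
    Matrix.GeneralLinearGroup.mkOfDetNeZero !![y - x, x; 0, 1] (by simpa using hyx)
  have hf : f 0 0 = y - x ∧ f 0 1 = x ∧ f 1 0 = 0 ∧ f 1 1 = 1 := by
    simp [f, Matrix.GeneralLinearGroup.mkOfDetNeZero]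
  refine ⟨g * f, ?_, ?_, ?_⟩
  · rw [mul_smul, OnePoint.smul_infty_eq_self_iff.2 hf.2.2.1]
  · rw [mul_smul, ← eq_inv_smul_iff, ← hx]
    simp [OnePoint.smul_some_eq_ite, hf]
  · rw [mul_smul, ← eq_inv_smul_iff, ← hy]
    simp [OnePoint.smul_some_eq_ite, hf]

theorem smul_eq_self_of_fixes_infty_zero_one {K : Type*} [Field K] [DecidableEq K]
    {g : GL (Fin 2) K} (h_infty : g • (∞ : OnePoint K) = ∞)
    (h_zero : g • ((0 : K) : OnePoint K) = ((0 : K) : OnePoint K))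
    (h_one : g • ((1 : K) : OnePoint K) = ((1 : K) : OnePoint K)) (x : OnePoint K) :
    g • x = x := by
  have h10 : g 1 0 = 0 := OnePoint.smul_infty_eq_self_iff.1 h_infty
  rw [OnePoint.smul_some_eq_ite] at h_zero h_one
  simp only [h10, zero_mul, zero_add, mul_zero] at h_zero h_one
  have h11 : g 1 1 ≠ 0 := fun h => by simp [h] at h_zero
  have h01 : g 0 1 = 0 := by simpa [h11] using h_zero
  have h00 : g 0 0 = g 1 1 := by simpa [h11, h01, div_eq_one_iff_eq] using h_one
  cases x with
  | infty => exact h_infty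
  | coe x => simp [OnePoint.smul_some_eq_ite, h10, h11, h01, h00]

variable (k L : Type*) [Field k] [Field L] [Algebra k L]

/-- The projective line over `k` as a subset of the projective line over an extension field `L`. -/
def baseSubline : Set (OnePoint L) :=
  Set.range (OnePoint.map (algebraMap k L))

/-- The `k`-sublines of the projective line over `L`: the images of the projective line over `k`
under projectivities. For `[L : k] = 2` these are the circles of the Miquelian inversive plane. -/
def IsSubline [DecidableEq L] (s : Set (OnePoint L)) : Prop :=
  ∃ g : GL (Fin 2) L, s = g • baseSubline k L

theorem map_algebraMap_smul_baseSubline [DecidableEq L] (h : GL (Fin 2) k) :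
    h.map (algebraMap k L) • baseSubline k L = baseSubline k L := by
  classical
  ext x
  constructor
  · rintro ⟨_, ⟨y, rfl⟩, rfl⟩
    exact ⟨h • y, OnePoint.map_smul _ _ _⟩
  · rintro ⟨y, rfl⟩
    refine ⟨_, ⟨h⁻¹ • y, rfl⟩, ?_⟩
    simp [← OnePoint.map_smul]

variable {k L}

theorem IsSubline.smul [DecidableEq L] {s : Set (OnePoint L)} (hs : IsSubline k L s)
    (g : GL (Fin 2) L) : IsSubline k L (g • s) := by
  obtain ⟨h, rfl⟩ := hs
  exact ⟨g * h, (mul_smul _ _ _).symm⟩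

theorem IsSubline.eq_baseSubline [DecidableEq L] {s : Set (OnePoint L)} (hs : IsSubline k L s)
    (h_infty : ∞ ∈ s) (h_zero : ((0 : L) : OnePoint L) ∈ s)
    (h_one : ((1 : L) : OnePoint L) ∈ s) : s = baseSubline k L := by
  classical
  obtain ⟨g, rfl⟩ := hs
  obtain ⟨_, ⟨a, rfl⟩, ha : g • OnePoint.map (algebraMap k L) a = ∞⟩ := h_infty
  obtain ⟨_, ⟨b, rfl⟩, hb : g • OnePoint.map (algebraMap k L) b = (0 : L)⟩ := h_zero
  obtain ⟨_, ⟨c, rfl⟩, hc : g • OnePoint.map (algebraMap k L) c = (1 : L)⟩ := h_one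
  obtain ⟨h, rfl, rfl, rfl⟩ := exists_smul_infty_zero_one_eq (a := a) (b := b) (c := c)
    (by rintro rfl; simp [ha] at hb) (by rintro rfl; simp [ha] at hc)
    (by rintro rfl; simp [hb] at hc)
  rw [OnePoint.map_smul, ← mul_smul] at ha hb hc
  have hfix : ∀ x : OnePoint L, (g * h.map (algebraMap k L)) • x = x :=
    smul_eq_self_of_fixes_infty_zero_one (by simpa using ha) (by simpa using hb)
      (by simpa using hc)
  calc g • baseSubline k L = (g * h.map (algebraMap k L)) • baseSubline k L := by
        rw [mul_smul, map_algebraMap_smul_baseSubline]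
    _ = baseSubline k L := by simp [← Set.image_smul, hfix]

variable (k) in
theorem existsUnique_isSubline [DecidableEq L] {a b c : OnePoint L} (hab : a ≠ b) (hac : a ≠ c)
    (hbc : b ≠ c) : ∃! s, IsSubline k L s ∧ a ∈ s ∧ b ∈ s ∧ c ∈ s := by
  obtain ⟨g, rfl, rfl, rfl⟩ := exists_smul_infty_zero_one_eq hab hac hbc
  refine ⟨g • baseSubline k L, ⟨⟨g, rfl⟩, ?_, ?_, ?_⟩, ?_⟩
  · exact Set.smul_mem_smul_set ⟨∞, rfl⟩
  · exact Set.smul_mem_smul_set ⟨((0 : k) : OnePoint k), by simp⟩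
  · exact Set.smul_mem_smul_set ⟨((1 : k) : OnePoint k), by simp⟩
  · rintro s ⟨hs, h_infty, h_zero, h_one⟩
    rw [← inv_smul_eq_iff]
    exact (hs.smul g⁻¹).eq_baseSubline (Set.mem_inv_smul_set_iff.2 h_infty)
      (Set.mem_inv_smul_set_iff.2 h_zero) (Set.mem_inv_smul_set_iff.2 h_one)

theorem IsSubline.ncard_eq [DecidableEq L] [Finite k] {s : Set (OnePoint L)}
    (hs : IsSubline k L s) : s.ncard = Nat.card k + 1 := by
  obtain ⟨g, rfl⟩ := hs
  have hinj : Function.Injective (OnePoint.map (algebraMap k L)) :=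
    Option.map_injective (algebraMap k L).injective
  rw [Set.ncard_smul_set, baseSubline, ← Set.image_univ, Set.ncard_image_of_injective _ hinj,
    Set.ncard_univ]
  exact Finite.card_option

end Sublines

section DesignExistence

theorem exists_isTDesign_of_existsUnique {P : Type*} [Finite P] (𝒞 : Set (Set P)) {t v k : ℕ}
    (ht : 0 < t) (htk : t ≤ k) (hkv : k < v) (hP : Nat.card P = v)
    (h_ncard : ∀ s ∈ 𝒞, s.ncard = k)
    (h_unique : ∀ Y : Finset P, Y.card = t → ∃! s, s ∈ 𝒞 ∧ (Y : Set P) ⊆ s) :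
    ∃ blocks : Finset (Finset (Fin v)), IsTDesign t v k 1 blocks := by
  classical
  let e : Fin v ≃ P := (Finite.equivFinOfCardEq hP).symm
  refine ⟨Finset.univ.filter fun A => e '' (A : Set (Fin v)) ∈ 𝒞, ht, one_pos, htk, hkv,
    Fintype.card_fin v, ?_, ?_⟩
  · intro A hA
    rw [← h_ncard _ (Finset.mem_filter.1 hA).2, Set.ncard_image_of_injective _ e.injective,
      Set.ncard_coe_finset]
  · intro Y hY
    obtain ⟨s, ⟨hs, hYs⟩, huniq⟩ := h_unique (Y.map e.toEmbedding) (by rwa [Finset.card_map])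
    rw [Finset.coe_map, Equiv.coe_toEmbedding] at hYs
    rw [Finset.card_eq_one]
    refine ⟨(e ⁻¹' s).toFinset, Finset.ext fun A => ?_⟩
    rw [Finset.filter_filter, Finset.mem_filter_univ, Finset.mem_singleton, ← Finset.coe_inj,
      Set.coe_toFinset, e.eq_preimage_iff_image_eq]
    constructor
    · rintro ⟨hA, hYA⟩
      exact huniq _ ⟨hA, by simpa using hYA⟩
    · rintro rfl
      exact ⟨hs, by simpa using hYs⟩

theorem exists_finite_field_extension {q n : ℕ} (hq : IsPrimePow q) (hn : n ≠ 0) :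
    ∃ (k L : Type) (_ : Field k) (_ : Field L) (_ : Algebra k L) (_ : Finite k) (_ : Finite L),
      Nat.card k = q ∧ Nat.card L = q ^ n := by
  obtain ⟨p, m, hp, hm, rfl⟩ := (isPrimePow_nat_iff q).1 hq
  have : Fact p.Prime := ⟨hp⟩
  have : NeZero n := ⟨hn⟩
  refine ⟨GaloisField p m, FiniteField.Extension (GaloisField p m) p n, inferInstance,
    inferInstance, inferInstance, inferInstance, inferInstance, GaloisField.card p m hm.ne', ?_⟩
  rw [FiniteField.natCard_extension, GaloisField.card p m hm.ne']

theorem exists_isTDesign_three_of_isPrimePow {q n : ℕ} (hq : IsPrimePow q) (hn : 2 ≤ n) :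
    ∃ blocks : Finset (Finset (Fin (q ^ n + 1))), IsTDesign 3 (q ^ n + 1) (q + 1) 1 blocks := by
  classical
  obtain ⟨k, L, _, _, _, _, _, hk, hL⟩ := exists_finite_field_extension hq (by omega : n ≠ 0)
  have hq2 : 2 ≤ q := hq.two_le
  have hqn : q < q ^ n := lt_self_pow₀ hq2 hn
  have : Finite (OnePoint L) := inferInstanceAs (Finite (Option L))
  have hP : Nat.card (OnePoint L) = q ^ n + 1 := hL ▸ Finite.card_option
  refine exists_isTDesign_of_existsUnique {s | IsSubline k L s} (by norm_num) (by omega)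
    (by omega) hP (fun s hs => hk ▸ hs.ncard_eq) fun Y hY => ?_
  obtain ⟨x, y, z, hxy, hxz, hyz, rfl⟩ := Finset.card_eq_three.1 hY
  simpa [Set.insert_subset_iff] using existsUnique_isSubline k hxy hxz hyz

end DesignExistence

section BlockIntersectionNumbers

variable {X : Type} [DecidableEq X] {blocks : Finset (Finset X)}

/-- The number of blocks that contain `Y` and are disjoint from `Z`; for a design and `Y`, `Z`
disjoint of small size, these are the block intersection numbers. -/
def blockCount (blocks : Finset (Finset X)) (Y Z : Finset X) : ℕ :=
  (blocks.filter fun A => Y ⊆ A ∧ Disjoint Z A).card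

theorem blockCount_insert_add_blockCount_insert (Y Z : Finset X) (z : X) :
    blockCount blocks (insert z Y) Z + blockCount blocks Y (insert z Z) =
      blockCount blocks Y Z := by
  unfold blockCount
  rw [← Finset.card_filter_add_card_filter_not (s := blocks.filter fun A => Y ⊆ A ∧ Disjoint Z A)
    (fun A => z ∈ A), Finset.filter_filter, Finset.filter_filter]
  congr 2 <;> ext A <;>
    simp only [Finset.mem_filter, Finset.insert_subset_iff, Finset.disjoint_insert_left] <;> tauto

variable [Fintype X]

/-- Double counting of the pairs of a `t`-set `T` and a block `A` with `Y ⊆ T ⊆ A`. -/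
theorem IsTDesign.blockCount_empty_mul_choose {t v k l : ℕ} (hD : IsTDesign t v k l blocks)
    {Y : Finset X} (hY : Y.card ≤ t) :
    blockCount blocks Y ∅ * (k - Y.card).choose (t - Y.card) =
      l * (v - Y.card).choose (t - Y.card) := by
  have h := Finset.sum_card_bipartiteAbove_eq_sum_card_bipartiteBelow
    (s := (Finset.univ.powersetCard t).filter (Y ⊆ ·)) (t := blocks.filter (Y ⊆ ·)) (· ⊆ ·)
  rw [Finset.sum_const_nat (m := l), Finset.sum_const_nat (m := (k - Y.card).choose (t - Y.card)),
    Finset.card_filter_powersetCard_subset _ _ _ (Finset.subset_univ Y) hY, Finset.card_univ,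
    hD.card_points] at h
  · simpa [blockCount, mul_comm l] using h.symm
  · intro A hA
    obtain ⟨hA, hYA⟩ := Finset.mem_filter.1 hA
    rw [← hD.card_block A hA, ← Finset.card_filter_powersetCard_subset Y A t hYA hY]
    congr 1
    ext T
    simp only [Finset.bipartiteBelow, Finset.mem_filter, Finset.mem_powersetCard]
    have := Finset.subset_univ T
    tauto
  · intro T hT
    obtain ⟨hT, hYT⟩ := Finset.mem_filter.1 hT
    rw [← hD.card_through T (Finset.mem_powersetCard_univ.1 hT), Finset.bipartiteAbove,
      Finset.filter_filter]
    congr 1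
    exact Finset.filter_congr fun A _ => and_iff_right_of_imp hYT.trans

end BlockIntersectionNumbers

section InversivePlane

variable {X : Type} [Fintype X] [DecidableEq X] {q : ℕ} {blocks : Finset (Finset X)}

namespace IsTDesign

theorem blockCount_triple (hD : IsTDesign 3 (q ^ 2 + 1) (q + 1) 1 blocks) {Y : Finset X}
    (hY : Y.card = 3) : blockCount blocks Y ∅ = 1 := by
  simpa [hY] using hD.blockCount_empty_mul_choose hY.le

theorem blockCount_pair (hD : IsTDesign 3 (q ^ 2 + 1) (q + 1) 1 blocks) {Y : Finset X}
    (hY : Y.card = 2) : blockCount blocks Y ∅ = q + 1 := by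
  have h := hD.blockCount_empty_mul_choose (hY.trans_le (by norm_num))
  rw [hY, Nat.choose_one_right, Nat.choose_one_right, one_mul] at h
  have hq : 2 ≤ q := by have := hD.t_le; omega
  refine Nat.eq_of_mul_eq_mul_right (by omega : 0 < q + 1 - 2) (h.trans ?_)
  rw [show q ^ 2 + 1 - 2 = q ^ 2 - 1 ^ 2 by omega, Nat.sq_sub_sq]
  rfl

theorem blockCount_point (hD : IsTDesign 3 (q ^ 2 + 1) (q + 1) 1 blocks) {Y : Finset X}
    (hY : Y.card = 1) : blockCount blocks Y ∅ = q * (q + 1) := by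
  have h := hD.blockCount_empty_mul_choose (hY.trans_le (by norm_num))
  rw [hY, Nat.add_sub_cancel, Nat.add_sub_cancel, one_mul] at h
  have hq : 2 ≤ q := by have := hD.t_le; omega
  have h_choose : (q ^ 2).choose 2 = q * (q + 1) * q.choose 2 := by
    have : ((q ^ 2).choose 2 : ℚ) = q * (q + 1) * q.choose 2 := by
      rw [Nat.cast_choose_two, Nat.cast_choose_two]
      push_cast
      ring
    exact_mod_cast this
  exact Nat.eq_of_mul_eq_mul_right (Nat.choose_pos hq) (h.trans h_choose)

theorem blockCount_pair_point (hD : IsTDesign 3 (q ^ 2 + 1) (q + 1) 1 blocks) {Y Z : Finset X}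
    (hYZ : Disjoint Y Z) (hY : Y.card = 2) (hZ : Z.card = 1) : blockCount blocks Y Z = q := by
  obtain ⟨z, rfl⟩ := Finset.card_eq_one.1 hZ
  have h := blockCount_insert_add_blockCount_insert (blocks := blocks) Y ∅ z
  rw [hD.blockCount_pair hY, hD.blockCount_triple (by
    rw [Finset.card_insert_of_notMem (Finset.disjoint_singleton_right.1 hYZ), hY])] at h
  exact add_left_cancel (h.trans (add_comm q 1))

theorem blockCount_point_pair (hD : IsTDesign 3 (q ^ 2 + 1) (q + 1) 1 blocks) {Y Z : Finset X}
    (hYZ : Disjoint Y Z) (hY : Y.card = 1) (hZ : Z.card = 2) :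
    blockCount blocks Y Z = q ^ 2 - q - 1 := by
  obtain ⟨y, z, hyz, rfl⟩ := Finset.card_eq_two.1 hZ
  obtain ⟨hyY, hzY⟩ : y ∉ Y ∧ z ∉ Y := by
    simpa [Finset.disjoint_insert_right] using hYZ
  have h_avoid_z := blockCount_insert_add_blockCount_insert (blocks := blocks) Y ∅ z
  have h_avoid_both := blockCount_insert_add_blockCount_insert (blocks := blocks) Y {z} y
  rw [hD.blockCount_point hY, hD.blockCount_pair (by
    rw [Finset.card_insert_of_notMem hzY, hY])] at h_avoid_z
  rw [hD.blockCount_pair_point (by simp [hzY, hyz.symm]) (by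
    rw [Finset.card_insert_of_notMem hyY, hY]) (Finset.card_singleton z)] at h_avoid_both
  rw [LawfulSingleton.insert_empty_eq] at h_avoid_z
  have hq : q * (q + 1) = q ^ 2 + q := by ring
  omega

end IsTDesign

end InversivePlane

namespace SubfileCode

variable {ρ φ : Type} {B : ℕ}

/-- Reed–Solomon codes: the columns of `G` are the vectors of powers of distinct scalars. -/
theorem exists_matrix_linearIndependent [Finite ρ] {F : Type*} [Field F] (α : φ ↪ F) :
    ∃ G : Matrix ρ φ F, ∀ g : ρ ↪ φ, LinearIndependent F fun i f => G f (g i) := by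
  classical
  have := Fintype.ofFinite ρ
  let e := Fintype.equivFin ρ
  refine ⟨fun f x => α x ^ (e f : ℕ), fun g => ?_⟩
  let V : Matrix ρ ρ F := (Matrix.vandermonde fun i => α (g (e.symm i))).submatrix e e
  have hV : V.det ≠ 0 := by
    rw [Matrix.det_submatrix_equiv_self, Matrix.det_vandermonde_ne_zero_iff]
    exact (α.injective.comp g.injective).comp e.symm.injective
  have hrow : (fun i f : ρ => α (g i) ^ (e f : ℕ)) = V.row := by
    funext i f
    simp [V, Matrix.row, Matrix.vandermonde]
  rw [hrow]
  exact Matrix.linearIndependent_rows_of_det_ne_zero hV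

theorem exists_m_pos (ρ φ : Type) [Fintype ρ] [Finite φ] :
    ∃ (B : ℕ) (C : SubfileCode ρ φ B), 0 < C.m ∧ B = Fintype.card ρ * C.m := by
  have := Fintype.ofFinite φ
  set m := Fintype.card φ + 1 with hm
  have := Fintype.ofFinite (GaloisField 2 m)
  have hcard : Fintype.card (GaloisField 2 m) = 2 ^ m := by
    rw [← Nat.card_eq_fintype_card, GaloisField.card 2 m (by omega)]
  obtain ⟨α⟩ : Nonempty (φ ↪ GaloisField 2 m) := by
    refine Function.Embedding.nonempty_of_card_le ?_
    have := Nat.lt_two_pow_self (n := m)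
    omega
  obtain ⟨G, hG⟩ := exists_matrix_linearIndependent (ρ := ρ) α
  exact ⟨Fintype.card ρ * m,
    { m := m
      F := GaloisField 2 m
      split := Fintype.equivOfCardEq (by simp)
      symbol := Fintype.equivOfCardEq (by simp [hcard])
      G := G
      mds := hG }, by simp [hm], rfl⟩

variable [Fintype ρ] (C : SubfileCode ρ φ B)

theorem eq_of_coded_eq [Finite φ] {w w' : Fin B → Bool} {s : Set φ}
    (hs : Fintype.card ρ ≤ s.ncard) (h : ∀ x ∈ s, C.coded w x = C.coded w' x) : w = w' := by
  classical
  have := Fintype.ofFinite s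
  obtain ⟨g⟩ : Nonempty (ρ ↪ s) :=
    Function.Embedding.nonempty_of_card_le (by
      rwa [← Nat.card_eq_fintype_card (α := s), Nat.card_coe_set_eq])
  let A : Matrix ρ ρ C.F := fun i f => C.G f (g i)
  have hA : IsUnit A := Matrix.linearIndependent_rows_iff_isUnit.1
    (C.mds (g.trans (Function.Embedding.subtype _)))
  have hsub : C.subfile w = C.subfile w' :=
    Matrix.mulVec_injective_iff_isUnit.2 hA (funext fun i => h (g i) (g i).2)
  funext b
  have := congrFun (C.symbol.injective (congrFun hsub (C.split b).1)) (C.split b).2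
  simpa using this

end SubfileCode

/-- A placement delivery array, with `none` for the star: an integer occurs at most once in each
column, and if it occurs in the columns `j` and `j'`, the row of the first occurrence has a star in
column `j'`. -/
structure IsPDA {ρ κ σ : Type*} (A : ρ → κ → Option σ) : Prop where
  row_eq : ∀ {f f' j s}, A f j = some s → A f' j = some s → f = f'
  eq_none : ∀ {f f' j j' s}, A f j = some s → A f' j' = some s → j ≠ j' → A f j' = none

namespace IsPDA

variable {ρ φ σ : Type} [Fintype ρ] [DecidableEq σ] {B K' : ℕ} {A : ρ → Fin K' → Option σ}

/-- All other summands of the transmission of `s` are in the cache of user `j`. -/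
theorem coded_eq_of_transmission_eq (hA : IsPDA A) (C : SubfileCode ρ φ B) (ψ : ρ ↪ φ)
    {w w' : Fin K' → Fin B → Bool} {f : ρ} {j : Fin K'} {s : σ} (hs : A f j = some s)
    (hcache : ∀ f' j', A f' j = none → C.coded (w j') (ψ f') = C.coded (w' j') (ψ f'))
    (htrans : C.transmission A ψ w s = C.transmission A ψ w' s) :
    C.coded (w j) (ψ f) = C.coded (w' j) (ψ f) := by
  classical
  have hother : ∀ p ∈ ({(f, j)}ᶜ : Finset (ρ × Fin K')),
      (if A p.1 p.2 = some s then C.coded (w p.2) (ψ p.1) else 0) =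
        if A p.1 p.2 = some s then C.coded (w' p.2) (ψ p.1) else 0 := by
    rintro ⟨f', j'⟩ hne
    rw [Finset.mem_compl] at hne
    refine ite_congr rfl (fun hs' => hcache f' j' ?_) fun _ => rfl
    refine hA.eq_none hs' hs ?_
    rintro rfl
    exact hne (Finset.mem_singleton.2 (Prod.ext (hA.row_eq hs' hs) rfl))
  unfold SubfileCode.transmission at htrans
  rw [← Fintype.sum_prod_type', ← Fintype.sum_prod_type', Fintype.sum_eq_add_sum_compl (f, j),
    Fintype.sum_eq_add_sum_compl (f, j), Finset.sum_congr rfl hother, add_left_inj] at htrans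
  simpa only [hs, if_true] using htrans

theorem eq_of_coded_eq_of_transmission_eq [Finite φ] (hA : IsPDA A)
    (C : SubfileCode ρ φ B) (ψ : ρ ↪ φ) {w w' : Fin K' → Fin B → Bool} {j : Fin K'}
    {cached : Set φ} {T : Set σ} (hψ : ∀ f, A f j = none ↔ ψ f ∈ cached)
    (hcard : Fintype.card ρ ≤ cached.ncard + {f | ∃ s ∉ T, A f j = some s}.ncard)
    (hcache : ∀ j', ∀ x ∈ cached, C.coded (w j') x = C.coded (w' j') x)
    (htrans : ∀ f, ∀ s ∉ T, A f j = some s →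
      C.transmission A ψ w s = C.transmission A ψ w' s) :
    w j = w' j := by
  let decoded : Set φ := ψ '' {f | ∃ s ∉ T, A f j = some s}
  have hdisj : Disjoint cached decoded := by
    rw [Set.disjoint_right]
    rintro _ ⟨f, ⟨s, -, hs⟩, rfl⟩ hf
    simp [(hψ f).2 hf] at hs
  refine C.eq_of_coded_eq (s := cached ∪ decoded) ?_ ?_
  · rwa [Set.ncard_union_eq hdisj, Set.ncard_image_of_injective _ ψ.injective]
  · rintro x (hx | ⟨f, ⟨s, hsT, hs⟩, rfl⟩)
    · exact hcache j x hx
    · exact hA.coded_eq_of_transmission_eq C ψ hs (fun f' j' hf' => hcache j' _ ((hψ f').1 hf'))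
        (htrans f s hsT hs)

end IsPDA

/-- A hotplug placement delivery array `(P, A)` with `Z` stars in each column of `P`: any `K'`
columns of `P` contain a copy of the star pattern of `A`. -/
structure IsHpPDA {ρ φ σ : Type*} {K K' : ℕ} (P : φ → Fin K → Prop)
    (A : ρ → Fin K' → Option σ) (Z : ℕ) : Prop where
  isPDA : IsPDA A
  ncard_column : ∀ k, {x | P x k}.ncard = Z
  exists_rows : ∀ u : Fin K' ↪o Fin K, ∃ ψ : ρ ↪ φ, ∀ f j, A f j = none ↔ P (ψ f) (u j)

namespace SubfileCode

/-- The bits of the field elements `x i`, in the order prescribed by `e`. -/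
def serialize {ρ φ ι : Type} {B c : ℕ} (C : SubfileCode ρ φ B) (e : Fin c ≃ ι × Fin C.m)
    (x : ι → C.F) (b : Fin c) : Bool :=
  C.symbol.symm (x (e b).1) (e b).2

theorem serialize_injective {ρ φ ι : Type} {B c : ℕ} (C : SubfileCode ρ φ B)
    (e : Fin c ≃ ι × Fin C.m) : Function.Injective (C.serialize e) := by
  intro x y h
  funext i
  refine C.symbol.symm.injective (funext fun b => ?_)
  simpa [serialize] using congrFun h (e.symm (i, b))

end SubfileCode

open scoped Classical in
/-- The scheme with the given placement and delivery, when the cache and the broadcast determine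
the demanded file. -/
noncomputable def HotplugScheme.ofDetermines {K K' N B c r : ℕ}
    (place : (Fin N → Fin B → Bool) → Fin K → Fin c → Bool)
    (deliver : (I : Finset (Fin K)) → (I → Fin N) → (Fin N → Fin B → Bool) → Fin r → Bool)
    (h : ∀ I : Finset (Fin K), I.card = K' → ∀ (d : I → Fin N) (k : I)
      (W W' : Fin N → Fin B → Bool), place W k = place W' k → deliver I d W = deliver I d W' →
        W (d k) = W' (d k)) :
    HotplugScheme K K' N B c r where
  place := place
  deliver := deliver
  decode I d k x y :=
    if hW : ∃ W, place W k = x ∧ deliver I d W = y then hW.choose (d k) else fun _ => false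
  correct I hI d W k := by
    have hW : ∃ W', place W' k = place W k ∧ deliver I d W' = deliver I d W := ⟨W, rfl, rfl⟩
    rw [dif_pos hW]
    exact h I hI d k _ _ hW.choose_spec.1 hW.choose_spec.2

theorem nonempty_broadcastBits {ρ κ σ : Type} [Finite ρ] [Finite κ] (A : ρ → κ → Option σ)
    (T : Set σ) (m : ℕ) :
    Nonempty (Fin ({s | s ∉ T ∧ ∃ f j, A f j = some s}.ncard * m) ≃
      {s // s ∉ T ∧ ∃ f j, A f j = some s} × Fin m) := by
  have hfin : {s | s ∉ T ∧ ∃ f j, A f j = some s}.Finite := by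
    refine Set.Finite.of_finite_image (f := some) ?_ (Option.some_injective σ).injOn
    refine (Set.finite_range fun p : ρ × κ => A p.1 p.2).subset ?_
    rintro _ ⟨s, ⟨-, f, j, hs⟩, rfl⟩
    exact ⟨(f, j), hs⟩
  have : Finite {s // s ∉ T ∧ ∃ f j, A f j = some s} := hfin
  exact ⟨(Finite.equivFinOfCardEq (by rw [Nat.card_prod, Nat.card_fin]; rfl)).symm⟩

namespace IsHpPDA

variable {ρ φ σ : Type} [Finite φ] {K K' Z : ℕ} {P : φ → Fin K → Prop} {A : ρ → Fin K' → Option σ}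

theorem nonempty_cacheBits (h : IsHpPDA P A Z) (N m : ℕ) (k : Fin K) :
    Nonempty (Fin (N * Z * m) ≃ (Fin N × {x // P x k}) × Fin m) := by
  have hZ : Nat.card {x // P x k} = Z := h.ncard_column k
  exact ⟨(Finite.equivFinOfCardEq (by simp [hZ])).symm⟩

theorem exists_isArrayScheme [Fintype ρ] [DecidableEq σ] (h : IsHpPDA P A Z) (N : ℕ) {T : Set σ}
    (hT : ∀ j, Fintype.card ρ ≤ Z + {f | ∃ s ∉ T, A f j = some s}.ncard) :
    ∃ (m B : ℕ) (S : HotplugScheme K K' N B (N * Z * m)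
      ({s | s ∉ T ∧ ∃ f j, A f j = some s}.ncard * m)),
      0 < m ∧ B = Fintype.card ρ * m ∧ IsArrayScheme P A T S := by
  obtain ⟨B, C, hm, hB⟩ := SubfileCode.exists_m_pos ρ φ
  let cacheBits := fun k => (h.nonempty_cacheBits N C.m k).some
  obtain ⟨broadcastBits⟩ := nonempty_broadcastBits A T C.m
  choose ψ hψ using fun (I : Finset (Fin K)) (hI : I.card = K') =>
    h.exists_rows (I.orderEmbOfFin hI)
  let place (W : Fin N → Fin B → Bool) (k : Fin K) :=
    C.serialize (cacheBits k) fun p => C.coded (W p.1) p.2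
  let deliver (I : Finset (Fin K)) (d : I → Fin N) (W : Fin N → Fin B → Bool) :=
    if hI : I.card = K' then
      C.serialize broadcastBits fun s =>
        C.transmission A (ψ I hI) (fun j => W (d (I.orderIsoOfFin hI j))) s
    else fun _ => false
  have hdecode (I : Finset (Fin K)) (hI : I.card = K') (d : I → Fin N) (k : I)
      (W W' : Fin N → Fin B → Bool) (hplace : place W k = place W' k)
      (hdeliver : deliver I d W = deliver I d W') : W (d k) = W' (d k) := by
    obtain ⟨j, rfl⟩ := (I.orderIsoOfFin hI).surjective k
    have hcache := congrFun (C.serialize_injective _ hplace)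
    simp only [deliver, dif_pos hI] at hdeliver
    have htrans := congrFun (C.serialize_injective _ hdeliver)
    exact h.isPDA.eq_of_coded_eq_of_transmission_eq C (ψ I hI)
      (cached := {x | P x (I.orderIsoOfFin hI j)}) (hψ I hI · j)
      (by simpa only [h.ncard_column] using hT j)
      (fun j' x hx => hcache (d (I.orderIsoOfFin hI j'), ⟨x, hx⟩))
      (fun f s hs hfs => htrans ⟨s, hs, f, j, hfs⟩)
  refine ⟨C.m, B, .ofDetermines place deliver hdecode, hm, hB, C,
    fun k => ⟨(cacheBits k).trans (Equiv.prodAssoc ..), fun _ _ => rfl⟩,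
    fun I hI => ⟨ψ I hI, hψ I hI, fun d => ⟨broadcastBits, fun W b => ?_⟩⟩⟩
  exact congrFun (dif_pos hI) b

end IsHpPDA

section DesignArrays

variable {t a₀ : ℕ} {a : ℕ → ℕ} {f : DesignRow t a} {j : Fin t}

theorem designDelivery_eq_none : designDelivery t a f j = none ↔ j ∈ f.1.1 := by
  unfold designDelivery
  split_ifs with h <;> simp [h]

theorem designDelivery_eq_some {s : Finset (Fin t) × ℕ} :
    designDelivery t a f j = some s ↔ j ∉ f.1.1 ∧ insert j f.1.1 = s.1 ∧ (f.2 : ℕ) = s.2 := by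
  unfold designDelivery
  split_ifs with h <;> simp [h, Prod.ext_iff]

theorem isPDA_designDelivery (t : ℕ) (a : ℕ → ℕ) : IsPDA (designDelivery t a) where
  row_eq := by
    rintro ⟨⟨Y, hY⟩, i⟩ ⟨⟨Y', hY'⟩, i'⟩ j s h h'
    obtain ⟨hj, hins, hi⟩ := designDelivery_eq_some.1 h
    obtain ⟨hj', hins', hi'⟩ := designDelivery_eq_some.1 h'
    obtain rfl : Y = Y' := by
      exact (Finset.erase_insert hj).symm.trans
        ((congrArg (·.erase j) (hins.trans hins'.symm)).trans (Finset.erase_insert hj'))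
    obtain rfl : i = i' := Fin.ext (hi.trans hi'.symm)
    rfl
  eq_none := by
    intro f f' j j' s h h' hne
    obtain ⟨-, hins, -⟩ := designDelivery_eq_some.1 h
    obtain ⟨-, hins', -⟩ := designDelivery_eq_some.1 h'
    have hmem : j' ∈ insert j f.1.1 := hins ▸ hins' ▸ Finset.mem_insert_self j' f'.1.1
    exact designDelivery_eq_none.2 (Finset.mem_of_mem_insert_of_ne hmem hne.symm)

theorem card_designRow (t : ℕ) (a : ℕ → ℕ) :
    Fintype.card (DesignRow t a) = ∑ s ∈ Finset.Ico 1 t, t.choose s * a s := by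
  have hproper (Y : Finset (Fin t)) : Y.Nonempty ∧ Y ≠ Finset.univ ↔ 1 ≤ Y.card ∧ Y.card < t := by
    rw [Nat.one_le_iff_ne_zero, Finset.card_ne_zero, ← Finset.card_lt_iff_ne_univ,
      Fintype.card_fin]
  rw [Fintype.card_sigma]
  simp only [Fintype.card_fin]
  calc ∑ Y : {Y : Finset (Fin t) // Y.Nonempty ∧ Y ≠ Finset.univ}, a Y.1.card
      = ∑ Y : Finset (Fin t), if 1 ≤ Y.card ∧ Y.card < t then a Y.card else 0 := by
        rw [← Finset.sum_filter]
        exact (Finset.sum_subtype _ (by simp [hproper]) fun Y : Finset (Fin t) => a Y.card).symm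
    _ = ∑ s ∈ Finset.range (t + 1), t.choose s * if 1 ≤ s ∧ s < t then a s else 0 := by
        rw [← Finset.powerset_univ,
          Finset.sum_powerset_apply_card fun s => if 1 ≤ s ∧ s < t then a s else 0]
        simp only [Finset.card_univ, Fintype.card_fin, smul_eq_mul]
    _ = ∑ s ∈ Finset.Ico 1 t, t.choose s * a s := by
        simp only [mul_ite, mul_zero]
        rw [← Finset.sum_filter]
        refine Finset.sum_congr ?_ fun _ _ => rfl
        ext s
        simp only [Finset.mem_filter, Finset.mem_range, Finset.mem_Ico]
        omega

theorem exists_designDelivery_eq_some_univ (ht : 2 ≤ t) {i : ℕ} :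
    (∃ f, designDelivery t a f j = some (Finset.univ, i)) ↔ i < a (t - 1) := by
  have hcard : ({j}ᶜ : Finset (Fin t)).card = t - 1 := by
    rw [Finset.card_compl, Fintype.card_fin, Finset.card_singleton]
  constructor
  · rintro ⟨f, hf⟩
    obtain ⟨hj, hins, rfl⟩ := designDelivery_eq_some.1 hf
    have hf : f.1.1 = {j}ᶜ := by rw [← Finset.erase_insert hj, hins, Finset.compl_singleton]
    exact f.2.2.trans_eq (by rw [hf, hcard])
  · intro hi
    have hne : ({j}ᶜ : Finset (Fin t)).Nonempty := Finset.card_pos.1 (by omega)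
    refine ⟨⟨⟨{j}ᶜ, hne, by simp⟩, i, by rwa [hcard]⟩, designDelivery_eq_some.2 ⟨by simp, ?_, rfl⟩⟩
    exact Finset.insert_compl_self j

/-- The integers of the delivery array that are not sent: all but the `([t], i)` with `a₀ ≤ i`.
Second components are numbered from `0`. -/
def redundantIntegers (t a₀ : ℕ) : Set (Finset (Fin t) × ℕ) :=
  {s | s.1 ≠ Finset.univ ∨ s.2 < a₀}

theorem notMem_redundantIntegers {s : Finset (Fin t) × ℕ} :
    s ∉ redundantIntegers t a₀ ↔ s.1 = Finset.univ ∧ a₀ ≤ s.2 := by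
  simp only [redundantIntegers, Set.mem_ofPred_eq, not_or, not_not, not_lt]

theorem ncard_sentIntegers (ht : 2 ≤ t) :
    {s | s ∉ redundantIntegers t a₀ ∧ ∃ f j, designDelivery t a f j = some s}.ncard =
      a (t - 1) - a₀ := by
  have hsent : {s | s ∉ redundantIntegers t a₀ ∧ ∃ f j, designDelivery t a f j = some s} =
      Prod.mk Finset.univ '' (Finset.Ico a₀ (a (t - 1)) : Set ℕ) := by
    ext ⟨Y, i⟩
    simp only [Set.mem_ofPred_eq, notMem_redundantIntegers, Set.mem_image, Finset.coe_Ico,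
      Set.mem_Ico, Prod.mk.injEq]
    constructor
    · rintro ⟨⟨rfl, hi⟩, f, j, hf⟩
      exact ⟨i, ⟨hi, (exists_designDelivery_eq_some_univ ht).1 ⟨f, hf⟩⟩, rfl, rfl⟩
    · rintro ⟨i, ⟨hi, hi'⟩, rfl, rfl⟩
      obtain ⟨f, hf⟩ := (exists_designDelivery_eq_some_univ (j := ⟨0, by omega⟩) ht).2 hi'
      exact ⟨⟨rfl, hi⟩, f, _, hf⟩
  rw [hsent, Set.ncard_image_of_injective _ (Prod.mk_right_injective _), Set.ncard_coe_finset,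
    Nat.card_Ico]

theorem ncard_sentRows (ht : 2 ≤ t) (j : Fin t) :
    {f | ∃ s ∉ redundantIntegers t a₀, designDelivery t a f j = some s}.ncard =
      a (t - 1) - a₀ := by
  rw [← Nat.card_Ico, ← Set.ncard_coe_finset]
  have hsent (f : DesignRow t a) : f ∈ {f | ∃ s ∉ redundantIntegers t a₀,
      designDelivery t a f j = some s} ↔
        a₀ ≤ f.2 ∧ designDelivery t a f j = some (Finset.univ, (f.2 : ℕ)) := by
    constructor
    · rintro ⟨⟨Y, i⟩, hs, hf⟩
      obtain ⟨rfl, hi⟩ := notMem_redundantIntegers.1 hs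
      obtain ⟨-, -, rfl⟩ := designDelivery_eq_some.1 hf
      exact ⟨hi, hf⟩
    · exact fun ⟨hi, hf⟩ => ⟨_, notMem_redundantIntegers.2 ⟨rfl, hi⟩, hf⟩
  refine Set.ncard_congr (fun f _ => (f.2 : ℕ)) (fun f hf => ?_) (fun f f' hf hf' hff' => ?_)
    fun i hi => ?_
  · obtain ⟨hi, hf⟩ := (hsent f).1 hf
    exact Finset.mem_coe.2
      (Finset.mem_Ico.2 ⟨hi, (exists_designDelivery_eq_some_univ ht).1 ⟨f, hf⟩⟩)
  · refine (isPDA_designDelivery t a).row_eq ((hsent f).1 hf).2 ?_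
    rw [hff']
    exact ((hsent f').1 hf').2
  · obtain ⟨hi, hi'⟩ := Finset.mem_Ico.1 (Finset.mem_coe.1 hi)
    obtain ⟨f, hf⟩ := (exists_designDelivery_eq_some_univ (j := j) ht).2 hi'
    obtain ⟨-, -, rfl⟩ := designDelivery_eq_some.1 hf
    exact ⟨f, (hsent f).2 ⟨hi, hf⟩, rfl⟩

theorem exists_designRow_embedding {X : Type} [DecidableEq X] {blocks : Finset (Finset X)}
    (u : Fin t ↪ X) (ha : ∀ Y : Finset (Fin t), Y.Nonempty → Y ≠ Finset.univ →
      a Y.card ≤ blockCount blocks (Y.map u) (Yᶜ.map u)) :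
    ∃ ψ : DesignRow t a ↪ {A // A ∈ blocks}, ∀ f j, j ∈ f.1.1 ↔ u j ∈ (ψ f).1 := by
  have hemb (Y : {Y : Finset (Fin t) // Y.Nonempty ∧ Y ≠ Finset.univ}) :
      Nonempty (Fin (a Y.1.card) ↪
        {A // A ∈ blocks.filter fun A => Y.1.map u ⊆ A ∧ Disjoint (Y.1ᶜ.map u) A}) :=
    Function.Embedding.nonempty_of_card_le (by
      simpa only [blockCount, Fintype.card_fin, Fintype.card_coe] using ha Y.1 Y.2.1 Y.2.2)
  let g := fun Y => (hemb Y).some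
  have hg Y i j : j ∈ Y.1 ↔ u j ∈ (g Y i).1 := by
    obtain ⟨-, hsub, hdisj⟩ := Finset.mem_filter.1 (g Y i).2
    refine ⟨fun hj => hsub (Finset.mem_map_of_mem u hj), fun hj => by_contra fun hjY => ?_⟩
    exact Finset.disjoint_left.1 hdisj
      (Finset.mem_map_of_mem u (Finset.mem_compl.2 hjY)) hj
  refine ⟨⟨fun f => ⟨(g f.1 f.2).1, Finset.mem_of_mem_filter _ (g f.1 f.2).2⟩, ?_⟩,
    fun f j => hg f.1 f.2 j⟩
  rintro ⟨Y, i⟩ ⟨Y', i'⟩ h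
  have hblock : (g Y i).1 = (g Y' i').1 := congrArg Subtype.val h
  obtain rfl : Y = Y' := by
    ext j
    rw [hg Y i, hg Y' i', hblock]
  rw [(g Y).injective (Subtype.ext hblock)]

theorem isHpPDA_design {K r : ℕ} {blocks : Finset (Finset (Fin K))}
    (hpoint : ∀ x, blockCount blocks {x} ∅ = r)
    (ha : ∀ Y Z : Finset (Fin K), Disjoint Y Z → Y.Nonempty → Z.Nonempty → Y.card + Z.card = t →
      a Y.card ≤ blockCount blocks Y Z) :
    IsHpPDA (designPlacement blocks) (designDelivery t a) r where
  isPDA := isPDA_designDelivery t a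
  ncard_column x := by
    rw [← hpoint x, blockCount, ← Set.ncard_coe_finset,
      ← Set.ncard_image_of_injective _ Subtype.val_injective]
    congr 1
    ext A
    simp [designPlacement, and_comm]
  exists_rows u := by
    obtain ⟨ψ, hψ⟩ := exists_designRow_embedding (a := a) (blocks := blocks) u.toEmbedding
      fun Y hY hYuniv => by
        rw [← Finset.card_map u.toEmbedding]
        refine ha _ _ ?_ (hY.map) ?_ ?_
        · exact (Finset.disjoint_map _).2 disjoint_compl_right
        · exact Finset.Nonempty.map (by rwa [← Finset.compl_ne_univ_iff_nonempty, compl_compl])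
        · rw [Finset.card_map, Finset.card_map, Finset.card_add_card_compl, Fintype.card_fin]
    exact ⟨ψ, fun f j => designDelivery_eq_none.trans (hψ f j)⟩

end DesignArrays

theorem IsTDesign.isHpPDA {q a₁ a₂ : ℕ} {blocks : Finset (Finset (Fin (q ^ 2 + 1)))}
    (hD : IsTDesign 3 (q ^ 2 + 1) (q + 1) 1 blocks) (ha₁ : a₁ ≤ q ^ 2 - q - 1) (ha₂ : a₂ ≤ q) :
    IsHpPDA (designPlacement blocks) (designDelivery 3 fun s => if s = 1 then a₁ else a₂)
      (q * (q + 1)) := by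
  refine isHpPDA_design (fun x => hD.blockCount_point (Finset.card_singleton x)) ?_
  intro Y Z hYZ hY hZ hcard
  rw [← Finset.card_pos] at hY hZ
  split_ifs with hY1
  · exact ha₁.trans_eq (hD.blockCount_point_pair hYZ hY1 (by omega)).symm
  · exact ha₂.trans_eq (hD.blockCount_pair_point hYZ (by omega) (by omega)).symm

theorem IsTDesign.exists_isArrayScheme {q a a₁ a₂ : ℕ}
    {blocks : Finset (Finset (Fin (q ^ 2 + 1)))}
    (hD : IsTDesign 3 (q ^ 2 + 1) (q + 1) 1 blocks) (N : ℕ) (ha₁ : a₁ ≤ q ^ 2 - q - 1)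
    (ha₂ : a₂ ≤ q) (ha : a < a₂) (hsum : q * (q + 1) = a + 3 * a₁ + 2 * a₂) :
    ∃ (m B : ℕ) (S : HotplugScheme (q ^ 2 + 1) 3 N B (N * (q * (q + 1)) * m) ((a₂ - a) * m)),
      0 < m ∧ B = 3 * (a₁ + a₂) * m ∧
      IsArrayScheme (designPlacement blocks)
        (designDelivery 3 (fun s => if s = 1 then a₁ else a₂)) (redundantIntegers 3 a) S := by
  have hrows : Fintype.card (DesignRow 3 fun s => if s = 1 then a₁ else a₂) = 3 * (a₁ + a₂) := by
    rw [card_designRow, Finset.sum_Ico_succ_top (by norm_num), Nat.Ico_succ_singleton,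
      Finset.sum_singleton, mul_add]
    rfl
  have h := (hD.isHpPDA ha₁ ha₂).exists_isArrayScheme N (T := redundantIntegers 3 a) fun j => by
    rw [ncard_sentRows (by norm_num), hrows, if_neg (by norm_num)]
    omega
  rwa [ncard_sentIntegers (by norm_num), hrows] at h

section CutSet

variable {K K' N : ℕ}

theorem HotplugScheme.cutSet {B c r s n : ℕ} (S : HotplugScheme K K' N B c r) (hK : K' ≤ K)
    (hs : 0 < s) (hsK : s ≤ K') (hn : n * s ≤ N) : n * s * B ≤ s * c + n * r := by
  obtain ⟨I, -, hI⟩ := Finset.exists_subset_card_eq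
    (show K' ≤ (Finset.univ : Finset (Fin K)).card by simpa using hK)
  obtain ⟨user⟩ : Nonempty (Fin s ↪ I) :=
    Function.Embedding.nonempty_of_card_le (by simpa [hI] using hsK)
  obtain ⟨file⟩ : Nonempty (Fin n × Fin s ↪ Fin N) :=
    Function.Embedding.nonempty_of_card_le (by simpa using hn)
  let demand (i : Fin n) : I → Fin N :=
    Function.extend user (fun j => file (i, j)) fun _ => file (i, ⟨0, hs⟩)
  let content (V : Fin n × Fin s → Fin B → Bool) : Fin N → Fin B → Bool :=
    Function.extend file V fun _ _ => false
  let received (V : Fin n × Fin s → Fin B → Bool) :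
      (Fin s → Fin c → Bool) × (Fin n → Fin r → Bool) :=
    (fun j => S.place (content V) (user j), fun i => S.deliver I (demand i) (content V))
  have hdecode V i j : S.decode I (demand i) (user j) ((received V).1 j) ((received V).2 i) =
      V (i, j) := by
    rw [S.correct I hI]
    simp only [demand, content, user.injective.extend_apply, file.injective.extend_apply]
  have hinj : Function.Injective received := fun V V' h => by
    funext ⟨i, j⟩
    rw [← hdecode V, ← hdecode V', h]
  have h := Fintype.card_le_of_injective received hinj
  simp only [Fintype.card_pi, Fintype.card_bool, Fintype.card_prod, Finset.prod_const,
    Finset.card_univ, Fintype.card_fin, ← pow_mul, ← pow_add] at h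
  have hexp := (Nat.pow_le_pow_iff_right (by norm_num)).1 h
  linarith

theorem IsAchievable.cutSet_le {s : ℕ} {M R : ℝ} (h : IsAchievable K K' N M R) (hK : K' ≤ K)
    (hs : s ∈ Set.Icc 1 (min N K')) : (s : ℝ) - (s : ℝ) / ((N / s : ℕ) : ℝ) * M ≤ R := by
  obtain ⟨B, c, r, hB, hc, hr, ⟨S⟩⟩ := h
  obtain ⟨hs1, hsN, hsK⟩ : 1 ≤ s ∧ s ≤ N ∧ s ≤ K' := by simpa using hs
  have hn : (0 : ℝ) < (N / s : ℕ) := by exact_mod_cast Nat.div_pos hsN hs1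
  have hB' : (0 : ℝ) < B := by exact_mod_cast hB
  have hbits : ((N / s : ℕ) : ℝ) * s * B ≤ s * c + (N / s : ℕ) * r := by
    exact_mod_cast S.cutSet hK hs1 hsK (Nat.div_mul_le_self N s)
  have hrate : ((N / s : ℕ) : ℝ) * s ≤ s * M + (N / s : ℕ) * R := by
    refine le_of_mul_le_mul_right ?_ hB'
    calc ((N / s : ℕ) : ℝ) * s * B ≤ s * c + (N / s : ℕ) * r := hbits
      _ ≤ s * (M * B) + (N / s : ℕ) * (R * B) := by gcongr
      _ = (s * M + (N / s : ℕ) * R) * B := by ring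
  refine le_of_mul_le_mul_left ?_ hn
  field_simp
  linarith

theorem IsAchievable.isOptimalRate_of_meetsCutSetBound {M R : ℝ} (h : IsAchievable K K' N M R)
    (hK : K' ≤ K) (hR : MeetsCutSetBound N K' M R) : IsOptimalRate K K' N M R := by
  obtain ⟨⟨s, hs, rfl⟩, -⟩ := hR
  exact ⟨h, fun R' h' => h'.cutSet_le hK hs⟩

theorem meetsCutSetBound_one_sub_div {M : ℝ} (hN : 0 < N) (hK' : 0 < K')
    (hM : 1 / 2 ≤ M / N) : MeetsCutSetBound N K' M (1 - M / N) := by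
  have hN' : (0 : ℝ) < N := by exact_mod_cast hN
  refine ⟨⟨1, ⟨le_rfl, le_min hN hK'⟩, by simp only [Nat.cast_one, Nat.div_one]; ring⟩, ?_⟩
  rintro _ ⟨s, ⟨hs, hs'⟩, rfl⟩
  have hs1 : (1 : ℝ) ≤ s := by exact_mod_cast hs
  have hdiv : (0 : ℝ) < (N / s : ℕ) := by
    exact_mod_cast Nat.div_pos (hs'.trans (min_le_left _ _)) hs
  have hM0 : 0 ≤ M := by
    rw [← div_mul_cancel₀ M hN'.ne']
    positivity
  have hfloor : (s : ℝ) ^ 2 * (M / N) ≤ s / ((N / s : ℕ) : ℝ) * M := by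
    calc (s : ℝ) ^ 2 * (M / N) = s / (N / s) * M := by field_simp
      _ ≤ s / ((N / s : ℕ) : ℝ) * M := by gcongr; exact Nat.cast_div_le
  have hprod : 0 ≤ ((s : ℝ) - 1) * ((s + 1) * (M / N) - 1) :=
    mul_nonneg (sub_nonneg.2 hs1) (by nlinarith)
  simp only
  linarith

end CutSet

theorem mainTheorem4 (q : ℕ) (hq : IsPrimePow q) (hq3 : 3 ≤ q) (N : ℕ) (hN : 0 < N)
    (a₁ a₂ a : ℕ) (ha₁ : a₁ ≤ q ^ 2 - q - 1) (ha₂ : a₂ ≤ q) (ha : a < a₂)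
    (hsum : q * (q + 1) = a + 3 * a₁ + 2 * a₂)
    (M R : ℝ) (hM : M / N = (q * (q + 1) : ℝ) / (3 * (a₁ + a₂)))
    (hR : R = (3 * (a₁ + a₂) - q * (q + 1) : ℝ) / (3 * (a₁ + a₂))) :
    (∃ blocks : Finset (Finset (Fin (q ^ 2 + 1))),
      IsTDesign 3 (q ^ 2 + 1) (q + 1) 1 blocks ∧
      ∃ (T : Set (Finset (Fin 3) × ℕ)) (B c r : ℕ) (S : HotplugScheme (q ^ 2 + 1) 3 N B c r),
        0 < B ∧ (c : ℝ) = M * B ∧ (r : ℝ) = R * B ∧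
        IsArrayScheme (designPlacement blocks)
          (designDelivery 3 (fun s => if s = 1 then a₁ else a₂)) T S) ∧
    R = 1 - M / N ∧
    MeetsCutSetBound N 3 M R ∧
    IsOptimalRate (q ^ 2 + 1) 3 N M R := by
  have hN' : (N : ℝ) ≠ 0 := Nat.cast_ne_zero.2 hN.ne'
  have hden : (0 : ℝ) < a₁ + a₂ := by exact_mod_cast (by omega : 0 < a₁ + a₂)
  have hsumR : (q * (q + 1) : ℝ) = a + 3 * a₁ + 2 * a₂ := by exact_mod_cast hsum
  have hRM : R = 1 - M / N := by rw [hR, hM, sub_div, div_self (by positivity)]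
  obtain ⟨blocks, hD⟩ := exists_isTDesign_three_of_isPrimePow hq (le_refl 2)
  obtain ⟨m, B, S, hm, hBm, hS⟩ := hD.exists_isArrayScheme N ha₁ ha₂ ha hsum
  have hB : 0 < B := hBm ▸ Nat.mul_pos (by omega) hm
  have hBR : (B : ℝ) = 3 * (a₁ + a₂) * m := by exact_mod_cast hBm
  have hc : ((N * (q * (q + 1)) * m : ℕ) : ℝ) = M * B := by
    rw [(div_eq_iff hN').1 hM, hBR]
    push_cast
    field_simp
  have hr : (((a₂ - a) * m : ℕ) : ℝ) = R * B := by
    rw [hR, hsumR, hBR]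
    push_cast [ha.le]
    field_simp
    ring
  have hcut : MeetsCutSetBound N 3 M R := by
    refine hRM ▸ meetsCutSetBound_one_sub_div hN (by norm_num) ?_
    rw [hM, hsumR, le_div_iff₀ (by positivity)]
    linarith [a.cast_nonneg (α := ℝ), a₁.cast_nonneg (α := ℝ), a₂.cast_nonneg (α := ℝ)]
  have hach : IsAchievable (q ^ 2 + 1) 3 N M R := ⟨B, _, _, hB, hc.le, hr.le, ⟨S⟩⟩
  exact ⟨⟨blocks, hD, _, B, _, _, S, hB, hc, hr, hS⟩, hRM, hcut,
    hach.isOptimalRate_of_meetsCutSetBound (by nlinarith) hcut⟩
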